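/- Let $\mathbb{K}$ be $\mathbb{R}$ or $\mathbb{C}$. For $0\le m\le n$ and $\mu\in\mathbb{K}^n$ let $\mathfrak{Q}_{n-m,m}(\mu_1,\dots,\mu_n)(\mathbb{K})$ be the quotient of the free Lie algebra over $\mathbb{K}$ on $x_1,\dots,x_n$ by the ideal generated by the relations $$\sum_{i=1}^{n-m}[x_i,[x_i,x_j]]-\sum_{i=n-m+1}^{n}[x_i,[x_i,x_j]]=\mu_jx_j,\qquad j=1,\dots,n.$$ Let $A=(a_{ij})$ be the Cartan matrix of type $E_{10}$, with simple roots labelled so that $\alpha_1,\dots,\alpha_9$ form, in this order, a chain of type $A_9$ in the Dynkin diagram and $\alpha_{10}$ is joined to $\alpha_7$ only. Let $\mathfrak{g}(E_{10})(\mathbb{K})$ be the Kac-Moody algebra of $A$, i.e. the Lie algebra over $\mathbb{K}$ on generators $e_i,h_i,f_i$ ($1\le i\le 10$) with relations $[h_i,e_j]=a_{ij}e_j$, $[h_i,f_j]=-a_{ij}f_j$, $[h_i,h_j]=0$, $[e_i,f_j]=\delta_{ij}h_i$, and, for $i\ne j$, $\operatorname{ad}(e_i)^{1-a_{ij}}(e_j)=0=\operatorname{ad}(f_i)^{1-a_{ij}}(f_j)$.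 For $\delta=\sum_jk_j\alpha_j$ with $k_j\in\mathbb{Z}$ put $\mathfrak{g}_\delta=\{x : [h_i,x]=(\sum_ja_{ij}k_j)\,x \text{ for all } i\}$. Set $\beta=\alpha_7+\alpha_{10}$ and let $$\Gamma=\{\alpha_i+\alpha_{i+1} : 1\le i\le 8\}\cup\{\alpha_i+\alpha_{i+1}+\alpha_{i+2} : 1\le i\le 7\}$$ be the set of the 15 positive roots of height 2 and 3 of the $A_9$-subsystem. Then $\mathfrak{g}_\delta\neq0$ for all $\delta\in\{\beta\}\cup\Gamma$. Moreover, for every choice of non-zero elements $e_\delta\in\mathfrak{g}_\delta$ ($\delta\in\{\beta\}\cup\Gamma$), the 26 elements $f_1,\dots,f_{10}$, $e_\beta$, $e_\gamma$ ($\gamma\in\Gamma$) have the following properties: 1. they generate the Lie algebra $\mathfrak{g}(E_{10})(\mathbb{K})$; 2. $\operatorname{ad}(x)^2(y)=0$ for all $x,y$ among them; 3. they are linearly independent over $\mathbb{K}$; 4. for every $0\le m\le 26$ there is an epimorphism of Lie algebras $\mathfrak{Q}_{26-m,m}(0,\dots,0)(\mathbb{K})\twoheadrightarrow\mathfrak{g}(E_{10})(\mathbb{K})$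 which sends the generators $x_1,\dots,x_{26}$ to these 26 elements, in the order listed ($x_i\mapsto f_i$ for $i\le 10$, $x_{11}\mapsto e_\beta$, then the $e_\gamma$ of height 2 and of height 3, each by increasing $i$). In particular the images of the generators are linearly independent. -/

import Mathlib

/-! ### Quantum minimal surface algebras -/

/-- The `j`-th relator
`∑_{i ≤ n-m} [x_i,[x_i,x_j]] - ∑_{i > n-m} [x_i,[x_i,x_j]] - μ_j x_j`
of the quantum minimal surface algebra of signature `(n-m, m)` and spectrum `μ`.
The index `i : Fin n` counts from `0`, so `i + m < n` singles out the first `n - m` generators. -/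
noncomputable def QMSA.relator (K : Type*) [Field K] (n m : ℕ) (μ : Fin n → K) (j : Fin n) :
    FreeLieAlgebra K (Fin n) :=
  (∑ i : Fin n, (if (i : ℕ) + m < n then (1 : K) else -1) •
      ⁅FreeLieAlgebra.of K i, ⁅FreeLieAlgebra.of K i, FreeLieAlgebra.of K j⁆⁆)
    - μ j • FreeLieAlgebra.of K j

/-- The ideal of the free Lie algebra generated by the relators. -/
noncomputable def QMSA.ideal (K : Type*) [Field K] (n m : ℕ) (μ : Fin n → K) :
    LieIdeal K (FreeLieAlgebra K (Fin n)) :=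
  LieSubmodule.lieSpan K (FreeLieAlgebra K (Fin n)) (Set.range (QMSA.relator K n m μ))

/-- The quantum minimal surface algebra of rank `n`, signature `(n-m, m)` (for `m ≤ n`) and
spectrum `μ`. -/
abbrev QMSA (K : Type*) [Field K] (n m : ℕ) (μ : Fin n → K) : Type _ :=
  FreeLieAlgebra K (Fin n) ⧸ QMSA.ideal K n m μ

/-- The generators `x_i` of the quantum minimal surface algebra. -/
noncomputable def QMSA.x (K : Type*) [Field K] (n m : ℕ) (μ : Fin n → K) (i : Fin n) :
    QMSA K n m μ :=
  LieSubmodule.Quotient.mk (FreeLieAlgebra.of K i)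

/-! ### Kac-Moody algebras

For an invertible symmetrizable generalized Cartan matrix `A`, the Kac-Moody algebra of `A` is
`Matrix.ToLieAlgebra K A`, the Lie algebra with the Chevalley generators and Serre relations. -/

/-- The quotient map from the free Lie algebra on the Chevalley generators. -/
noncomputable def KacMoody.mk (K : Type*) [Field K] {ι : Type*} [DecidableEq ι]
    (A : Matrix ι ι ℤ) (g : FreeLieAlgebra K (CartanMatrix.Generators ι)) :
    Matrix.ToLieAlgebra K A :=
  LieSubmodule.Quotient.mk (N := CartanMatrix.Relations.toIdeal K A) g

/-- The Chevalley generator `h_i`. -/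
noncomputable def KacMoody.h (K : Type*) [Field K] {ι : Type*} [DecidableEq ι]
    (A : Matrix ι ι ℤ) (i : ι) : Matrix.ToLieAlgebra K A :=
  KacMoody.mk K A (FreeLieAlgebra.of K (CartanMatrix.Generators.H i))

/-- The Chevalley generator `f_i`. -/
noncomputable def KacMoody.f (K : Type*) [Field K] {ι : Type*} [DecidableEq ι]
    (A : Matrix ι ι ℤ) (i : ι) : Matrix.ToLieAlgebra K A :=
  KacMoody.mk K A (FreeLieAlgebra.of K (CartanMatrix.Generators.F i))

/-- For `A` invertible over `ℚ`, the root space of `∑ j, k j • α_j`: the elements `x` with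
`[h, x] = (∑ j, k j • α_j)(h) • x` for all `h` in the Cartan subalgebra, which is spanned by the
`h_i`, where `α_j(h_i) = A i j`. -/
def KacMoody.rootSpace (K : Type*) [Field K] {ι : Type*} [Fintype ι] [DecidableEq ι]
    (A : Matrix ι ι ℤ) (k : ι → ℤ) : Submodule K (Matrix.ToLieAlgebra K A) where
  carrier := {x | ∀ i, ⁅KacMoody.h K A i, x⁆ = ((∑ j, A i j * k j : ℤ) : K) • x}
  add_mem' := by
    intro x y hx hy i
    rw [lie_add, hx i, hy i, smul_add]
  zero_mem' := by
    intro i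
    rw [lie_zero, smul_zero]
  smul_mem' := by
    intro c x hx i
    rw [lie_smul, hx i, smul_comm]

/-- A non-zero element of the root lattice is a root if its root space is non-zero. -/
def KacMoody.IsRoot (K : Type*) [Field K] {ι : Type*} [Fintype ι] [DecidableEq ι]
    (A : Matrix ι ι ℤ) (k : ι → ℤ) : Prop :=
  k ≠ 0 ∧ KacMoody.rootSpace K A k ≠ ⊥

/-! ### The example of type `E₁₀` -/

/-- The Cartan matrix of type `E₁₀`, with the labelling of the Dynkin diagram in which
`α_1 - α_2 - ⋯ - α_9` is a chain and `α_10` is attached to `α_7`.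
(The index `i : Fin 10` stands for `α_{i+1}`.) -/
def E10.cartan : Matrix (Fin 10) (Fin 10) ℤ :=
  !![ 2, -1,  0,  0,  0,  0,  0,  0,  0,  0;
     -1,  2, -1,  0,  0,  0,  0,  0,  0,  0;
      0, -1,  2, -1,  0,  0,  0,  0,  0,  0;
      0,  0, -1,  2, -1,  0,  0,  0,  0,  0;
      0,  0,  0, -1,  2, -1,  0,  0,  0,  0;
      0,  0,  0,  0, -1,  2, -1,  0,  0,  0;
      0,  0,  0,  0,  0, -1,  2, -1,  0, -1;
      0,  0,  0,  0,  0,  0, -1,  2, -1,  0;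
      0,  0,  0,  0,  0,  0,  0, -1,  2,  0;
      0,  0,  0,  0,  0,  0, -1,  0,  0,  2]

/-- The Kac-Moody algebra of type `E₁₀` over `K`. -/
abbrev E10.LieAlg (K : Type*) [Field K] : Type _ := Matrix.ToLieAlgebra K E10.cartan

/-- The simple root `α_{i+1}` (for `i < 10`) as an element of the root lattice. -/
def E10.simpleRoot (i : ℕ) : Fin 10 → ℤ := fun j => if (j : ℕ) = i then 1 else 0

/-- `β = α_7 + α_10`. -/
def E10.beta : Fin 10 → ℤ := E10.simpleRoot 6 + E10.simpleRoot 9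

/-- The 8 roots `α_i + α_{i+1}` of height 2 of the subsystem `A₉` spanned by `α_1, …, α_9`. -/
def E10.gammaTwo (i : Fin 8) : Fin 10 → ℤ := E10.simpleRoot i + E10.simpleRoot (i + 1)

/-- The 7 roots `α_i + α_{i+1} + α_{i+2}` of height 3 of the subsystem `A₉`. -/
def E10.gammaThree (i : Fin 7) : Fin 10 → ℤ :=
  E10.simpleRoot i + E10.simpleRoot (i + 1) + E10.simpleRoot (i + 2)

/-- The 16 roots `β`, `α_i + α_{i+1}` (`1 ≤ i ≤ 8`), `α_i + α_{i+1} + α_{i+2}` (`1 ≤ i ≤ 7`). -/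
def E10.roots : Fin 16 → Fin 10 → ℤ :=
  Fin.cons (α := fun _ => Fin 10 → ℤ) E10.beta
    (Fin.append E10.gammaTwo E10.gammaThree : Fin (8 + 7) → Fin 10 → ℤ)

/-- The 26 elements `f_1, …, f_10, e_0, …, e_15` for a family `e` of 16 elements. -/
noncomputable def E10.chi (K : Type*) [Field K] (e : Fin 16 → E10.LieAlg K) :
    Fin 26 → E10.LieAlg K :=
  (Fin.append (KacMoody.f K E10.cartan) e : Fin (10 + 16) → E10.LieAlg K)

/-! Everything is read off from weights. The element `[x,[x,y]]` has weight `2γ + δ`, where `γ`, `δ`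
are the weights of `x`, `y` among the 26, and no such vector is zero or a root. Hence all the double
brackets vanish, each summand of a relator is zero whatever its sign, and every signature `m` is
allowed. Linear independence holds because the 26 weights are distinct. For generation, each `α_i`
is one of the height 2 roots minus some `α_j`, so bracketing with `f_j` recovers `e_i` up to a
non-zero scalar.

To make this rigorous for an algebra given only by generators and relations, two facts are needed.
The first is that the algebra does not collapse: `h_ne_zero` lets the algebra without Serre
relations act on a Verma module and shows that the Serre ideal cannot contain `h_i`. The second is
control of the support of the root space decomposition. The triangular decomposition and the
invertibility of `A` give `rootSpace_eq_span`, so vectors of mixed sign and proper multiples of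
simple roots have zero root space. Local nilpotency of `ad e_i`, `ad f_i` and `𝔰𝔩₂`-theory give
stability under simple reflections (`rootSpace_reflect_ne_bot`).

Reflecting simple roots then yields the 16 roots, and reflecting `2γ + δ` to an evidently impossible
weight yields the vanishing. Both are finite computations. -/

namespace KacMoody

/-! ### Chevalley relations, `𝔰𝔩₂` computations and the span of the Serre elements -/

section Abstract

variable {ι L : Type*} [DecidableEq ι] [LieRing L]

/-- The relations between the Chevalley generators, without the Serre relations. -/
structure ChevalleyRelations (A : Matrix ι ι ℤ) (h e f : ι → L) : Prop where
  lie_h_h : ∀ i j, ⁅h i, h j⁆ = 0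
  lie_e_f : ∀ i j, ⁅e i, f j⁆ = if i = j then h i else 0
  lie_h_e : ∀ i j, ⁅h i, e j⁆ = A i j • e j
  lie_h_f : ∀ i j, ⁅h i, f j⁆ = -(A i j • f j)

/-- The Chevalley involution. -/
lemma ChevalleyRelations.symm {A : Matrix ι ι ℤ} {h e f : ι → L}
    (H : ChevalleyRelations A h e f) : ChevalleyRelations A (-h) f e where
  lie_h_h i j := by simp [H.lie_h_h]
  lie_e_f i j := by
    rw [← lie_skew, H.lie_e_f]
    by_cases hij : i = j
    · simp [hij]
    · simp [hij, Ne.symm hij]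
  lie_h_e i j := by simp [H.lie_h_f]
  lie_h_f i j := by simp [H.lie_h_e]

/-- The defining properties of a generalized Cartan matrix. -/
structure IsGCM (A : Matrix ι ι ℤ) : Prop where
  diag : ∀ i, A i i = 2
  nonpos : ∀ i j, i ≠ j → A i j ≤ 0
  zero_symm : ∀ i j, A i j = 0 → A j i = 0

variable {K : Type*} [Field K] [LieAlgebra K L]

lemma lie_ad_pow_of_weight {h f x : L} {μ ν : K} (hf : ⁅h, f⁆ = ν • f) (hx : ⁅h, x⁆ = μ • x)
    (n : ℕ) : ⁅h, (LieAlgebra.ad K L f ^ n) x⁆ = (μ + n * ν) • (LieAlgebra.ad K L f ^ n) x := by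
  induction n with
  | zero => simp [hx]
  | succ n ih =>
    rw [pow_succ', Module.End.mul_apply, LieAlgebra.ad_apply, leibniz_lie, hf, ih, lie_smul,
      smul_lie, ← add_smul]
    push_cast
    congr 1
    ring

lemma lie_ad_pow_of_commute {y f x : L} (hf : ⁅y, f⁆ = 0) (n : ℕ) :
    ⁅y, (LieAlgebra.ad K L f ^ n) x⁆ = (LieAlgebra.ad K L f ^ n) ⁅y, x⁆ := by
  induction n with
  | zero => simp
  | succ n ih =>
    rw [pow_succ', Module.End.mul_apply, Module.End.mul_apply, LieAlgebra.ad_apply, leibniz_lie,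
      hf, ih, zero_lie, zero_add, LieAlgebra.ad_apply]

lemma lie_ad_pow_of_sl2 {h e f x : L} {μ : K} (hef : ⁅e, f⁆ = h) (hf : ⁅h, f⁆ = (-2 : K) • f)
    (hx : ⁅h, x⁆ = μ • x) (n : ℕ) :
    ⁅e, (LieAlgebra.ad K L f ^ (n + 1)) x⁆ = (LieAlgebra.ad K L f ^ (n + 1)) ⁅e, x⁆
      + ((n + 1) * (μ - n)) • (LieAlgebra.ad K L f ^ n) x := by
  induction n with
  | zero => simp [leibniz_lie e f x, hef, hx, add_comm]
  | succ n ih =>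
    rw [pow_succ', Module.End.mul_apply, LieAlgebra.ad_apply, leibniz_lie, hef,
      lie_ad_pow_of_weight hf hx, ih, lie_add, lie_smul, ← LieAlgebra.ad_apply K L f,
      ← LieAlgebra.ad_apply K L f, ← Module.End.mul_apply, ← Module.End.mul_apply, ← pow_succ',
      ← pow_succ', add_left_comm, ← add_smul]
    push_cast
    congr 2
    ring

/-- In a representation of `𝔰𝔩₂` on which `e` acts locally nilpotently, `f ^ m` is injective on
the weight space of weight `m`. -/
lemma eq_zero_of_ad_pow_eq_zero [CharZero K] {h e f : L} (hef : ⁅e, f⁆ = h)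
    (he : ⁅h, e⁆ = (2 : K) • e) (hf : ⁅h, f⁆ = (-2 : K) • f) (N : ℕ) :
    ∀ (m : ℕ) (x : L), ⁅h, x⁆ = (m : K) • x → (LieAlgebra.ad K L e ^ N) x = 0 →
      (LieAlgebra.ad K L f ^ m) x = 0 → x = 0 := by
  induction N with
  | zero => intro m x _ hx _; simpa using hx
  | succ N ih =>
    intro m x hx hN hm
    have h1 : (LieAlgebra.ad K L f ^ (m + 1)) x = 0 := by
      rw [pow_succ', Module.End.mul_apply, hm, map_zero]
    have h2 : (LieAlgebra.ad K L f ^ (m + 2)) x = 0 := by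
      rw [pow_succ', Module.End.mul_apply, h1, map_zero]
    -- The vector `[e, x]` has weight `m + 2` and is killed by `e ^ N`. Commuting `e` past `f ^ (m +
    -- 2)` shows that it is also killed by `f ^ (m + 2)`, so induction applies.
    have hu : ⁅e, x⁆ = 0 := by
      refine ih (m + 2) _ ?_ ?_ ?_
      · rw [leibniz_lie, he, hx, lie_smul, smul_lie, ← add_smul]
        push_cast
        congr 1
        ring
      · rwa [pow_succ, Module.End.mul_apply, LieAlgebra.ad_apply] at hN
      · have := lie_ad_pow_of_sl2 hef hf hx (m + 1)
        rw [h2, h1, lie_zero, smul_zero, add_zero] at this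
        exact this.symm
    -- Now `x` is a highest weight vector, so `e f ^ (n + 1) x = (n + 1)(m - n) f ^ n x`. The factor
    -- is non-zero for `n < m`, which allows descent from `m` to `0`.
    have key : ∀ n ≤ m, (LieAlgebra.ad K L f ^ n) x = 0 → x = 0 := by
      intro n
      induction n with
      | zero => intro _ h0; simpa using h0
      | succ n ihn =>
        intro hn h0
        refine ihn (by omega) ?_
        have := lie_ad_pow_of_sl2 hef hf hx n
        rw [h0, hu, lie_zero, map_zero, zero_add] at this
        refine (smul_eq_zero.mp this.symm).resolve_left (mul_ne_zero ?_ ?_)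
        · exact_mod_cast n.succ_ne_zero
        · rw [sub_ne_zero]
          exact_mod_cast (by omega : m ≠ n)
    exact key m le_rfl hm

/-- The Serre element `ad(e_i)^{1 - a_{ij}} (e_j)`. -/
def serre (K : Type*) [Field K] [LieAlgebra K L] (A : Matrix ι ι ℤ) (e : ι → L) (i j : ι) : L :=
  (LieAlgebra.ad K L (e i) ^ ((-A i j).toNat + 1)) (e j)

/-- For `k = i` this is the `𝔰𝔩₂` formula with the roles of `e` and `f` exchanged: `e_j` has weight
`-a_{ij}` for `-h_i`, and the exponent is exactly the one where the factor `μ - n` vanishes. For `k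
= j` the bracket is a multiple of `ad(e_i)^{-a_{ij}} (e_i)`. Otherwise `f_k` commutes with both
letters. -/
lemma ChevalleyRelations.lie_f_serre {A : Matrix ι ι ℤ} (hA : IsGCM A) {h e f : ι → L}
    (H : ChevalleyRelations A h e f) {i j : ι} (hij : i ≠ j) (k : ι) :
    ⁅f k, serre K A e i j⁆ = 0 := by
  have hfe := H.symm.lie_e_f
  unfold serre
  by_cases hk : k = i
  · subst hk
    have hf : ⁅(-h) k, e k⁆ = (-2 : K) • e k := by
      rw [H.symm.lie_h_f, hA.diag, ← Int.cast_smul_eq_zsmul K]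
      simp
    have hx : ⁅(-h) k, e j⁆ = (((-A k j).toNat : ℕ) : K) • e j := by
      rw [H.symm.lie_h_f, ← Int.cast_smul_eq_zsmul K, ← neg_smul]
      congr 1
      have : (((-A k j).toNat : ℕ) : ℤ) = -A k j := Int.toNat_of_nonneg (by
        have := hA.nonpos k j hij
        omega)
      rw [← Int.cast_natCast, this]
      simp
    rw [lie_ad_pow_of_sl2 (by rw [hfe, if_pos rfl]) hf hx, hfe, if_neg hij]
    simp
  · rw [lie_ad_pow_of_commute (by rw [hfe, if_neg hk]), hfe]
    split_ifs with hkj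
    · subst hkj
      rw [pow_succ, Module.End.mul_apply, LieAlgebra.ad_apply, ← lie_skew]
      simp only [Pi.neg_apply, neg_lie, neg_neg, H.lie_h_e]
      rcases hn : (-A i k).toNat with _ | n
      -- The exponent leaves no `ad(e_i)` to kill `e_i`; here the coefficient `a_{ki}` itself is
      -- zero.
      · have h0 : A i k = 0 := by
          have := hA.nonpos i k hij
          omega
        simp [hA.zero_symm _ _ h0]
      · rw [map_zsmul, pow_succ, Module.End.mul_apply, LieAlgebra.ad_apply, lie_self]
        simp
    · simp

lemma ChevalleyRelations.lie_h_serre {A : Matrix ι ι ℤ} {h e f : ι → L}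
    (H : ChevalleyRelations A h e f) (i j k : ι) :
    ∃ c : K, ⁅h k, serre K A e i j⁆ = c • serre K A e i j :=
  ⟨_, lie_ad_pow_of_weight (ν := (A k i : K)) (μ := (A k j : K))
    (by rw [H.lie_h_e, Int.cast_smul_eq_zsmul]) (by rw [H.lie_h_e, Int.cast_smul_eq_zsmul]) _⟩

/-- Iterated brackets `[e_{i_1}, [e_{i_2}, … [e_{i_r}, s]]]` with `s ∈ S`. -/
inductive AdWord (e : ι → L) (S : Set L) : L → Prop
  | base {x : L} : x ∈ S → AdWord e S x
  | step (i : ι) {x : L} : AdWord e S x → AdWord e S ⁅e i, x⁆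

/-- A submodule which is stable under the adjoint action of a spanning set of generators is
stable under the whole adjoint action. -/
lemma lie_mem_of_lieSpan_eq_top {s : Set L} (hs : LieSubalgebra.lieSpan K L s = ⊤)
    (V : Submodule K L) (hV : ∀ y ∈ s, ∀ x ∈ V, ⁅y, x⁆ ∈ V) (y : L) {x : L} (hx : x ∈ V) :
    ⁅y, x⁆ ∈ V := by
  have hy : y ∈ LieSubalgebra.lieSpan K L s := hs ▸ LieSubalgebra.mem_top _
  induction hy using LieSubalgebra.lieSpan_induction generalizing x with
  | mem y h => exact hV y h x hx
  | zero => simp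
  | add y z _ _ h1 h2 => rw [add_lie]; exact add_mem (h1 hx) (h2 hx)
  | smul a y _ h => rw [smul_lie]; exact V.smul_mem _ (h hx)
  | lie y z _ _ h1 h2 => rw [lie_lie]; exact sub_mem (h1 (h2 hx)) (h2 (h1 hx))

lemma lie_mem_of_forall_mem_span {s : Set L} {W : Submodule K L} {y : L}
    (h : ∀ x ∈ s, ⁅y, x⁆ ∈ W) {x : L} (hx : x ∈ Submodule.span K s) : ⁅y, x⁆ ∈ W := by
  induction hx using Submodule.span_induction with
  | mem x hx => exact h x hx
  | zero => simp
  | add x z _ _ h1 h2 => rw [lie_add]; exact add_mem h1 h2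
  | smul a x _ h => rw [lie_smul]; exact W.smul_mem _ h

/-- The set of Serre elements of the family `e`. -/
def serreSet (K : Type*) [Field K] [LieAlgebra K L] (A : Matrix ι ι ℤ) (e : ι → L) : Set L :=
  {x | ∃ i j, i ≠ j ∧ x = serre K A e i j}

/-- The span of the iterated brackets of the `e_i` with a Serre element. -/
def serreSpan (K : Type*) [Field K] [LieAlgebra K L] (A : Matrix ι ι ℤ) (e : ι → L) :
    Submodule K L :=
  Submodule.span K {x | AdWord e (serreSet K A e) x}

omit [DecidableEq ι] in
lemma lie_e_mem_serreSpan {A : Matrix ι ι ℤ} {e : ι → L} (i : ι) {x : L}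
    (hx : x ∈ serreSpan K A e) : ⁅e i, x⁆ ∈ serreSpan K A e :=
  lie_mem_of_forall_mem_span (fun _ hy => Submodule.subset_span (AdWord.step i hy)) hx

lemma ChevalleyRelations.lie_h_mem_serreSpan {A : Matrix ι ι ℤ} {h e f : ι → L}
    (H : ChevalleyRelations A h e f) (k : ι) {x : L}
    (hx : x ∈ serreSpan K A e) : ⁅h k, x⁆ ∈ serreSpan K A e := by
  refine lie_mem_of_forall_mem_span (fun y hy => ?_) hx
  induction hy with
  | base hy =>
    obtain ⟨i, j, hij, rfl⟩ := hy
    obtain ⟨c, hc⟩ := H.lie_h_serre (K := K) i j k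
    rw [hc]
    exact Submodule.smul_mem _ _ (Submodule.subset_span (.base ⟨i, j, hij, rfl⟩))
  | step i hy ih =>
    rw [leibniz_lie, H.lie_h_e, zsmul_lie]
    exact add_mem (zsmul_mem (lie_e_mem_serreSpan i (Submodule.subset_span hy)) _)
      (lie_e_mem_serreSpan i ih)

lemma ChevalleyRelations.lie_f_mem_serreSpan {A : Matrix ι ι ℤ} (hA : IsGCM A) {h e f : ι → L}
    (H : ChevalleyRelations A h e f) (k : ι) {x : L}
    (hx : x ∈ serreSpan K A e) : ⁅f k, x⁆ ∈ serreSpan K A e := by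
  refine lie_mem_of_forall_mem_span (fun y hy => ?_) hx
  induction hy with
  | base hy =>
    obtain ⟨i, j, hij, rfl⟩ := hy
    rw [H.lie_f_serre hA hij]
    exact zero_mem _
  | step i hy ih =>
    rw [leibniz_lie, H.symm.lie_e_f]
    refine add_mem ?_ (lie_e_mem_serreSpan i ih)
    split_ifs
    · rw [Pi.neg_apply, neg_lie]
      exact neg_mem (H.lie_h_mem_serreSpan k (Submodule.subset_span hy))
    · simp

end Abstract

/-! ### A Verma module, and the non-vanishing of the `h_i` -/

section Verma

attribute [local instance] LieRing.ofAssociativeRing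

variable (K : Type*) [Field K] {ι : Type*} (A : Matrix ι ι ℤ)

/-- The eigenvalue of `h_i` on the basis vector `f_{w_1} ⋯ f_{w_r} v` of the Verma module of
highest weight `(1, 1, …)`. -/
def Verma.weight (i : ι) (w : List ι) : ℤ := 1 - (w.map (A i)).sum

/-- The action of `h_i` on the Verma module over the algebra without Serre relations. -/
noncomputable def Verma.h (i : ι) : Module.End K (List ι →₀ K) :=
  Finsupp.linearCombination K fun w => (Verma.weight A i w : K) • Finsupp.single w 1

/-- The action of `f_i` on the Verma module over the algebra without Serre relations. -/
noncomputable def Verma.f (i : ι) : Module.End K (List ι →₀ K) :=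
  Finsupp.linearCombination K fun w => Finsupp.single (i :: w) 1

/-- The action of `e_i` on the basis of the Verma module. -/
noncomputable def Verma.eBasis [DecidableEq ι] (i : ι) : List ι → (List ι →₀ K)
  | [] => 0
  | j :: w => Verma.f K j (Verma.eBasis i w)
      + if i = j then Verma.h K A i (Finsupp.single w 1) else 0

/-- The action of `e_i` on the Verma module over the algebra without Serre relations. -/
noncomputable def Verma.e [DecidableEq ι] (i : ι) : Module.End K (List ι →₀ K) :=
  Finsupp.linearCombination K (Verma.eBasis K A i)

lemma Verma.h_single (i : ι) (w : List ι) :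
    Verma.h K A i (Finsupp.single w 1) = (Verma.weight A i w : K) • Finsupp.single w 1 := by
  rw [Verma.h, Finsupp.linearCombination_single, one_smul]

lemma Verma.f_single (i : ι) (w : List ι) :
    Verma.f K i (Finsupp.single w 1) = Finsupp.single (i :: w) 1 := by
  rw [Verma.f, Finsupp.linearCombination_single, one_smul]

lemma Verma.e_single [DecidableEq ι] (i : ι) (w : List ι) :
    Verma.e K A i (Finsupp.single w 1) = Verma.eBasis K A i w := by
  rw [Verma.e, Finsupp.linearCombination_single, one_smul]

variable {K} in
lemma Verma.ext {x y : Module.End K (List ι →₀ K)}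
    (h : ∀ w, x (Finsupp.single w 1) = y (Finsupp.single w 1)) : x = y :=
  Finsupp.lhom_ext' fun w => LinearMap.ext_ring (h w)

-- The words in the `f_i` applied to the vacuum span the module. This reduces `[h_i, e_j] = a_{ij}
-- e_j` to a check on the vacuum and commutators with the `f_l`.
variable {K} in
lemma Verma.eq_zero_of_commute_f {x : Module.End K (List ι →₀ K)}
    (h0 : x (Finsupp.single [] 1) = 0) (h : ∀ i, x * Verma.f K i - Verma.f K i * x = 0) :
    x = 0 := by
  refine Verma.ext fun w => ?_
  induction w with
  | nil => simpa using h0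
  | cons i w ih =>
    have := LinearMap.congr_fun (h i) (Finsupp.single w 1)
    simp only [LinearMap.sub_apply, Module.End.mul_apply, Verma.f_single, ih,
      LinearMap.zero_apply, map_zero, sub_zero] at this
    simpa using this

/-- In an associative algebra, the commutators `[[h_i, e_j] - a_{ij} e_j, f_l]` vanish as soon as
the relations not involving `[h_i, e_j]` hold. -/
lemma commute_f_of_mul {R : Type*} [Ring R] [DecidableEq ι] {h e f : ι → R}
    (hh : ∀ i j, h i * h j - h j * h i = 0)
    (ef : ∀ i j, e i * f j - f j * e i = if i = j then h i else 0)
    (hf : ∀ i j, h i * f j - f j * h i = -(A i j • f j)) (i j l : ι) :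
    (h i * e j - e j * h i - A i j • e j) * f l - f l * (h i * e j - e j * h i - A i j • e j)
      = 0 := by
  simp only [← Ring.lie_def] at *
  rw [sub_lie, lie_lie, ef, zsmul_lie, ef, hf, lie_neg, lie_zsmul, ef]
  split_ifs with hjl
  · subst hjl
    simp [hh]
  · simp

lemma chevalleyRelations_of_mul {R : Type*} [Ring R] [DecidableEq ι] {h e f : ι → R}
    (hh : ∀ i j, h i * h j - h j * h i = 0)
    (ef : ∀ i j, e i * f j - f j * e i = if i = j then h i else 0)
    (he : ∀ i j, h i * e j - e j * h i = A i j • e j)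
    (hf : ∀ i j, h i * f j - f j * h i = -(A i j • f j)) : ChevalleyRelations A h e f where
  lie_h_h i j := by rw [Ring.lie_def, hh]
  lie_e_f i j := by rw [Ring.lie_def, ef]
  lie_h_e i j := by rw [Ring.lie_def, he]
  lie_h_f i j := by rw [Ring.lie_def, hf]

lemma Verma.chevalleyRelations [DecidableEq ι] :
    ChevalleyRelations A (Verma.h K A) (Verma.e K A) (Verma.f K) := by
  have hh : ∀ i j, Verma.h K A i * Verma.h K A j - Verma.h K A j * Verma.h K A i = 0 :=
    fun i j => Verma.ext fun w => by
      simp only [LinearMap.sub_apply, Module.End.mul_apply, Verma.h_single,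
        LinearMap.zero_apply, map_smul]
      rw [smul_comm, sub_self]
  have ef : ∀ i j, Verma.e K A i * Verma.f K j - Verma.f K j * Verma.e K A i
      = if i = j then Verma.h K A i else 0 :=
    fun i j => Verma.ext fun w => by
      simp only [LinearMap.sub_apply, Module.End.mul_apply, Verma.f_single,
        Verma.e_single, Verma.eBasis, add_sub_cancel_left]
      split_ifs <;> rfl
  have hf : ∀ i j, Verma.h K A i * Verma.f K j - Verma.f K j * Verma.h K A i
      = -(A i j • Verma.f K j) :=
    fun i j => Verma.ext fun w => by
      simp only [LinearMap.sub_apply, Module.End.mul_apply, Verma.f_single,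
        Verma.h_single, map_smul, LinearMap.neg_apply, LinearMap.smul_apply, ← sub_smul]
      rw [← Int.cast_smul_eq_zsmul K, ← neg_smul]
      congr 1
      simp [Verma.weight]
  refine chevalleyRelations_of_mul A hh ef (fun i j => ?_) hf
  rw [← sub_eq_zero]
  refine Verma.eq_zero_of_commute_f ?_ fun l => commute_f_of_mul A hh ef hf i j l
  simp only [LinearMap.sub_apply, Module.End.mul_apply, LinearMap.smul_apply, Verma.e_single,
    Verma.h_single, Verma.eBasis, map_smul, map_zero, smul_zero, sub_zero]

variable {K A}

lemma lieSpan_range_freeLieAlgebra_of (X : Type*) :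
    LieSubalgebra.lieSpan K (FreeLieAlgebra K X) (Set.range (FreeLieAlgebra.of K)) = ⊤ := by
  set S := LieSubalgebra.lieSpan K (FreeLieAlgebra K X) (Set.range (FreeLieAlgebra.of K))
  have : S.incl.comp (FreeLieAlgebra.lift K fun x =>
      (⟨FreeLieAlgebra.of K x, LieSubalgebra.subset_lieSpan ⟨x, rfl⟩⟩ : S)) = LieHom.id := by
    refine FreeLieAlgebra.hom_ext fun x => ?_
    simp
  rw [eq_top_iff]
  intro y _
  have hy := LieHom.congr_fun this y
  rw [LieHom.id_apply] at hy
  rw [← hy]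
  exact Subtype.property _

/-- The sum of the two Serre spans is stable under all generators, so its preimage is an ideal; it
contains every relator, since the non-Serre ones map to zero. -/
lemma map_mem_of_mem_toIdeal [DecidableEq ι] {L : Type*} [LieRing L] [LieAlgebra K L]
    (hA : IsGCM A) {h e f : ι → L} (H : ChevalleyRelations A h e f)
    (ρ : FreeLieAlgebra K (CartanMatrix.Generators ι) →ₗ⁅K⁆ L)
    (hh : ∀ i, ρ (.of K (.H i)) = h i) (he : ∀ i, ρ (.of K (.E i)) = e i)
    (hf : ∀ i, ρ (.of K (.F i)) = f i)
    {x : FreeLieAlgebra K (CartanMatrix.Generators ι)}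
    (hx : x ∈ CartanMatrix.Relations.toIdeal K A) :
    ρ x ∈ serreSpan K A e ⊔ serreSpan K A f := by
  set V := serreSpan K A e ⊔ serreSpan K A f with hV
  have stab : ∀ y : L, (∀ x ∈ serreSpan K A e, ⁅y, x⁆ ∈ serreSpan K A e) →
      (∀ x ∈ serreSpan K A f, ⁅y, x⁆ ∈ serreSpan K A f) → ∀ x ∈ V, ⁅y, x⁆ ∈ V := by
    intro y h1 h2 x hx
    obtain ⟨a, ha, b, hb, rfl⟩ := Submodule.mem_sup.mp hx
    rw [lie_add]
    exact Submodule.add_mem_sup (h1 a ha) (h2 b hb)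
  let I : LieIdeal K (FreeLieAlgebra K (CartanMatrix.Generators ι)) :=
    { V.comap (ρ : _ →ₗ[K] L) with
      lie_mem := fun {y x} hx => by
        refine lie_mem_of_lieSpan_eq_top (lieSpan_range_freeLieAlgebra_of _)
          (V.comap (ρ : _ →ₗ[K] L)) ?_ y hx
        rintro _ ⟨g, rfl⟩ x hx
        simp only [Submodule.mem_comap, LieHom.coe_toLinearMap, LieHom.map_lie] at hx ⊢
        rcases g with i | i | i
        · rw [hh]
          refine stab _ (fun _ => H.lie_h_mem_serreSpan i) (fun x hx => ?_) _ hx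
          have := H.symm.lie_h_mem_serreSpan i hx
          rwa [Pi.neg_apply, neg_lie, neg_mem_iff] at this
        · rw [he]
          exact stab _ (fun _ => lie_e_mem_serreSpan i)
            (fun _ => H.symm.lie_f_mem_serreSpan hA i) _ hx
        · rw [hf]
          exact stab _ (fun _ => H.lie_f_mem_serreSpan hA i)
            (fun _ => lie_e_mem_serreSpan i) _ hx }
  have key : CartanMatrix.Relations.toIdeal K A ≤ I := by
    refine LieSubmodule.lieSpan_le.mpr ?_
    have had : ∀ (y : FreeLieAlgebra K (CartanMatrix.Generators ι)) (n : ℕ) x,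
        ρ ((LieAlgebra.ad K _ y ^ n) x) = (LieAlgebra.ad K L (ρ y) ^ n) (ρ x) := by
      intro y n x
      induction n with
      | zero => simp
      | succ n ih => simp [pow_succ', Module.End.mul_apply, ih]
    have hser : ∀ (e : ι → L) i j, (LieAlgebra.ad K L (e i) ^ (-A i j).toNat) ⁅e i, e j⁆ ∈
        serreSpan K A e := by
      intro e i j
      -- The relators also run over `i = j`, where they are trivial because `[e_i, e_i] = 0`.
      by_cases hij : i = j
      · subst hij
        simp
      · refine Submodule.subset_span (.base ⟨i, j, hij, ?_⟩)
        rw [serre, pow_succ, Module.End.mul_apply, LieAlgebra.ad_apply]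
    rintro x (((((⟨⟨i, j⟩, rfl⟩ | ⟨⟨i, j⟩, rfl⟩) | ⟨⟨i, j⟩, rfl⟩) | ⟨⟨i, j⟩, rfl⟩) |
      ⟨⟨i, j⟩, rfl⟩) | ⟨⟨i, j⟩, rfl⟩) <;> change ρ _ ∈ V
    · simp [CartanMatrix.Relations.HH, hh, H.lie_h_h]
    · have := H.lie_e_f i j
      simp only [CartanMatrix.Relations.EF, Function.uncurry, Function.comp_apply]
      split_ifs at this ⊢ with hij
      · subst hij
        simp [hh, he, hf, this]
      · simp [he, hf, this]
    · simp [CartanMatrix.Relations.HE, hh, he, H.lie_h_e]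
    · simp [CartanMatrix.Relations.HF, hh, hf, H.lie_h_f]
    · refine Submodule.mem_sup_left ?_
      simpa [CartanMatrix.Relations.adE, had, he] using hser e i j
    · refine Submodule.mem_sup_right ?_
      simpa [CartanMatrix.Relations.adF, had, hf] using hser f i j
  exact key hx

lemma serreSpan_le_of_mul_mem {R : Type*} [Ring R] [Algebra K R] {e : ι → R}
    (P : Submodule K R) (hP : ∀ x ∈ P, ∀ y ∈ P, x * y ∈ P) (he : ∀ i, e i ∈ P) :
    serreSpan K A e ≤ P := by
  have hlie : ∀ x ∈ P, ∀ y ∈ P, ⁅x, y⁆ ∈ P := fun x hx y hy => by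
    rw [Ring.lie_def]
    exact sub_mem (hP _ hx _ hy) (hP _ hy _ hx)
  refine Submodule.span_le.mpr fun x hx => ?_
  induction hx with
  | base hx =>
    obtain ⟨i, j, -, rfl⟩ := hx
    unfold serre
    generalize (-A i j).toNat + 1 = n
    induction n with
    | zero => exact he j
    | succ n ih =>
      rw [pow_succ', Module.End.mul_apply]
      exact hlie _ (he i) _ ih
  | step i _ ih => exact hlie _ (he i) _ ih

/-- The Chevalley generators `h_i` do not vanish in the Kac-Moody algebra. -/
lemma h_ne_zero [DecidableEq ι] (hA : IsGCM A) (i : ι) : h K A i ≠ 0 := by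
  intro h0
  let ρ : FreeLieAlgebra K (CartanMatrix.Generators ι) →ₗ⁅K⁆ Module.End K (List ι →₀ K) :=
    FreeLieAlgebra.lift K fun
      | .H i => Verma.h K A i
      | .E i => Verma.e K A i
      | .F i => Verma.f K i
  have hmem := map_mem_of_mem_toIdeal hA (Verma.chevalleyRelations K A) ρ (fun i => by simp [ρ])
    (fun i => by simp [ρ]) (fun i => by simp [ρ]) (LieSubmodule.Quotient.mk_eq_zero'.mp h0)
  -- The vacuum expectation value. It is `1` on `h_i`, by the choice of highest weight, but vanishes
  -- on both Serre spans.
  let ε : Module.End K (List ι →₀ K) →ₗ[K] K :=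
    (Finsupp.lapply []).comp (LinearMap.applyₗ (Finsupp.single [] 1))
  have hker : serreSpan K A (Verma.e K A) ⊔ serreSpan K A (Verma.f (ι := ι) K) ≤ ε.ker := by
    refine sup_le ?_ ?_
    -- Operators that kill the vacuum.
    · let P : Submodule K (Module.End K (List ι →₀ K)) :=
        LinearMap.ker (LinearMap.applyₗ (R := K) (M₂ := List ι →₀ K)
          (Finsupp.single ([] : List ι) (1 : K)))
      refine (serreSpan_le_of_mul_mem P (fun x hx y hy => ?_) fun i => ?_).trans
        (LinearMap.ker_le_ker_comp _ _)
      · have hy : y (Finsupp.single [] 1) = 0 := hy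
        change x (y _) = 0
        rw [hy, map_zero]
      · exact Verma.e_single K A i []
    -- Operators whose image has no vacuum component.
    · let P : Submodule K (Module.End K (List ι →₀ K)) :=
        LinearMap.ker (LinearMap.compRight K (M := List ι →₀ K)
          (Finsupp.lapply (R := K) (M := K) ([] : List ι)))
      refine (serreSpan_le_of_mul_mem P (fun x hx y hy => ?_) fun i => ?_).trans ?_
      · exact LinearMap.ext fun w => LinearMap.congr_fun (f := Finsupp.lapply [] ∘ₗ x) hx (y w)
      · refine Finsupp.lhom_ext' fun w => LinearMap.ext_ring ?_
        change (Verma.f K i (Finsupp.single w 1)) [] = 0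
        simp [Verma.f_single]
      · exact fun x hx => LinearMap.congr_fun (f := Finsupp.lapply [] ∘ₗ x) hx (Finsupp.single [] 1)
  have := hker hmem
  simp [ρ, ε, Verma.h_single, Verma.weight] at this

end Verma

/-! ### Iterated brackets and the triangular decomposition -/

section Words

variable {ι L : Type*} [DecidableEq ι] [LieRing L]

/-- Iterated brackets of the `e_i`, with their weights. -/
inductive RootWord (e : ι → L) : L → (ι → ℤ) → Prop
  | base (i : ι) : RootWord e (e i) (Pi.single i 1)
  | step (i : ι) {x : L} {k : ι → ℤ} : RootWord e x k → RootWord e ⁅e i, x⁆ (k + Pi.single i 1)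

lemma RootWord.nonneg {e : ι → L} {x : L} {k : ι → ℤ} (hx : RootWord e x k) : 0 ≤ k := by
  induction hx with
  | base i => simp
  | step i _ ih => exact add_nonneg ih (by simp)

/-- All letters are `e_i`, so a word of length at least two contains `[e_i, e_i] = 0`. -/
lemma RootWord.eq_zero_or_eq_simple {e : ι → L} {x : L} {k : ι → ℤ} (hx : RootWord e x k) (i : ι)
    (hk : ∀ j, j ≠ i → k j = 0) : x = 0 ∨ x = e i ∧ k = Pi.single i 1 := by
  induction hx with
  | base j =>
    by_cases hj : j = i
    · subst hj
      exact .inr ⟨rfl, rfl⟩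
    · simpa using hk j hj
  | @step j x k hx ih =>
    have hj : j = i := by
      by_contra hj
      have h1 := hk j hj
      have h2 := hx.nonneg j
      simp only [Pi.add_apply, Pi.single_eq_same, Pi.zero_apply] at h1 h2
      omega
    subst hj
    rcases ih fun l hl => by simpa [Pi.single_eq_of_ne hl] using hk l hl with h | ⟨h, -⟩
    · exact .inl (by rw [h, lie_zero])
    · exact .inl (by rw [h, lie_self])

variable {K : Type*} [Field K] [LieAlgebra K L] {A : Matrix ι ι ℤ} {h e f : ι → L}

lemma RootWord.lie_h [Fintype ι] (H : ChevalleyRelations A h e f) {x : L} {k : ι → ℤ}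
    (hx : RootWord e x k) (i : ι) : ⁅h i, x⁆ = (∑ j, A i j * k j) • x := by
  induction hx with
  | base j => simp [H.lie_h_e, Pi.single_apply]
  | step j _ ih =>
    rw [leibniz_lie, H.lie_h_e, ih, lie_zsmul, zsmul_lie, ← add_zsmul]
    congr 1
    simp [mul_add, Finset.sum_add_distrib, Pi.single_apply, add_comm]

/-- The span of the iterated brackets of the `e_i`. -/
def wordSpan (K : Type*) [Field K] [LieAlgebra K L] (e : ι → L) : Submodule K L :=
  Submodule.span K {x | ∃ k, RootWord e x k}

lemma lie_e_mem_wordSpan (i : ι) {x : L} (hx : x ∈ wordSpan K e) : ⁅e i, x⁆ ∈ wordSpan K e := by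
  refine lie_mem_of_forall_mem_span (fun y hy => ?_) hx
  obtain ⟨k, hy⟩ := hy
  exact Submodule.subset_span ⟨_, .step i hy⟩

lemma ChevalleyRelations.lie_h_mem_wordSpan [Fintype ι] (H : ChevalleyRelations A h e f) (i : ι)
    {x : L} (hx : x ∈ wordSpan K e) : ⁅h i, x⁆ ∈ wordSpan K e := by
  refine lie_mem_of_forall_mem_span (fun y hy => ?_) hx
  obtain ⟨k, hy⟩ := hy
  rw [hy.lie_h H]
  exact zsmul_mem (show y ∈ wordSpan K e from Submodule.subset_span ⟨k, hy⟩) _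

lemma ChevalleyRelations.lie_e_mem_of_mem_span_h (H : ChevalleyRelations A h e f) (i : ι)
    {x : L} (hx : x ∈ Submodule.span K (Set.range h)) : ⁅e i, x⁆ ∈ wordSpan K e :=
  lie_mem_of_forall_mem_span (fun y hy => by
    obtain ⟨j, rfl⟩ := hy
    rw [← lie_skew, H.lie_h_e]
    exact neg_mem (zsmul_mem (Submodule.subset_span (by exact ⟨_, .base i⟩)) _)) hx

lemma ChevalleyRelations.lie_f_mem_wordSpan [Fintype ι] (H : ChevalleyRelations A h e f) (i : ι)
    {x : L} (hx : x ∈ wordSpan K e) :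
    ⁅f i, x⁆ ∈ Submodule.span K (Set.range h) ⊔ wordSpan K e := by
  refine lie_mem_of_forall_mem_span (fun y hy => ?_) hx
  obtain ⟨k, hy⟩ := hy
  induction hy with
  | base j =>
    refine Submodule.mem_sup_left ?_
    rw [H.symm.lie_e_f]
    split_ifs
    · exact neg_mem (Submodule.subset_span ⟨i, rfl⟩)
    · exact zero_mem _
  | @step j y k hy ih =>
    refine Submodule.mem_sup_right ?_
    rw [leibniz_lie, H.symm.lie_e_f]
    refine add_mem ?_ ?_
    · split_ifs
      · rw [Pi.neg_apply, neg_lie]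
        exact neg_mem (H.lie_h_mem_wordSpan i (Submodule.subset_span ⟨k, hy⟩))
      · simp
    · obtain ⟨a, ha, b, hb, hab⟩ := Submodule.mem_sup.mp ih
      rw [← hab, lie_add]
      exact add_mem (H.lie_e_mem_of_mem_span_h j ha) (lie_e_mem_wordSpan j hb)

/-- The triangular decomposition. -/
lemma ChevalleyRelations.sup_eq_top [Fintype ι] (H : ChevalleyRelations A h e f)
    (hgen : LieSubalgebra.lieSpan K L (Set.range h ∪ Set.range e ∪ Set.range f) = ⊤) :
    Submodule.span K (Set.range h) ⊔ wordSpan K e ⊔ wordSpan K f = ⊤ := by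
  -- The Chevalley involution replaces `h` by `-h`; the span is the same, so the statements for `e`
  -- transfer to `f`.
  have hneg : Submodule.span K (Set.range (-h)) ≤ Submodule.span K (Set.range h) := by
    rw [Submodule.span_le]
    rintro _ ⟨i, rfl⟩
    exact neg_mem (Submodule.subset_span ⟨i, rfl⟩)
  have hneg' : Submodule.span K (Set.range h) ≤ Submodule.span K (Set.range (-h)) := by
    rw [Submodule.span_le]
    rintro _ ⟨i, rfl⟩
    exact neg_mem_iff.mp (Submodule.subset_span ⟨i, rfl⟩)
  set V := Submodule.span K (Set.range h) ⊔ wordSpan K e ⊔ wordSpan K f with hV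
  have h0 : Submodule.span K (Set.range h) ≤ V := le_sup_left.trans le_sup_left
  have h1 : wordSpan K e ≤ V := le_sup_right.trans le_sup_left
  have h2 : wordSpan K f ≤ V := le_sup_right
  have stab : ∀ y ∈ Set.range h ∪ Set.range e ∪ Set.range f, ∀ x ∈ V, ⁅y, x⁆ ∈ V := by
    intro y hy x hx
    obtain ⟨x', hx', c, hc, rfl⟩ := Submodule.mem_sup.mp hx
    obtain ⟨a, ha, b, hb, rfl⟩ := Submodule.mem_sup.mp hx'
    rw [lie_add, lie_add]
    rcases hy with (⟨i, rfl⟩ | ⟨i, rfl⟩) | ⟨i, rfl⟩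
    · refine add_mem (add_mem ?_ (h1 (H.lie_h_mem_wordSpan i hb))) (h2 ?_)
      · refine lie_mem_of_forall_mem_span (fun y hy => ?_) ha
        obtain ⟨j, rfl⟩ := hy
        rw [H.lie_h_h]
        exact zero_mem _
      · have := H.symm.lie_h_mem_wordSpan i hc
        rwa [Pi.neg_apply, neg_lie, neg_mem_iff] at this
    · exact add_mem (add_mem (h1 (H.lie_e_mem_of_mem_span_h i ha)) (h1 (lie_e_mem_wordSpan i hb)))
        (sup_le (hneg.trans h0) h2 (H.symm.lie_f_mem_wordSpan i hc))
    · exact add_mem (add_mem (h2 (H.symm.lie_e_mem_of_mem_span_h i (hneg' ha)))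
        (sup_le h0 h1 (H.lie_f_mem_wordSpan i hb))) (h2 (lie_e_mem_wordSpan i hc))
  let S : LieSubalgebra K L :=
    { V with lie_mem' := fun {y x} _ hx => lie_mem_of_lieSpan_eq_top hgen V stab y hx }
  have hS : (⊤ : LieSubalgebra K L) ≤ S := by
    rw [← hgen, LieSubalgebra.lieSpan_le]
    rintro y ((⟨i, rfl⟩ | ⟨i, rfl⟩) | ⟨i, rfl⟩)
    · exact h0 (Submodule.subset_span ⟨i, rfl⟩)
    · exact h1 (Submodule.subset_span ⟨_, .base i⟩)
    · exact h2 (Submodule.subset_span ⟨_, .base i⟩)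
  exact eq_top_iff.mpr fun x _ => hS (LieSubalgebra.mem_top x)

end Words

/-! ### Chevalley generators of the Kac-Moody algebra and local nilpotency -/

section Algebra

variable (K : Type*) [Field K] {ι : Type*} [DecidableEq ι] (A : Matrix ι ι ℤ)

/-- The Chevalley generator `e_i`. -/
noncomputable def e (i : ι) : Matrix.ToLieAlgebra K A :=
  mk K A (FreeLieAlgebra.of K (CartanMatrix.Generators.E i))

/-- The quotient map as a homomorphism of Lie algebras. -/
noncomputable def mkHom :
    FreeLieAlgebra K (CartanMatrix.Generators ι) →ₗ⁅K⁆ Matrix.ToLieAlgebra K A where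
  toFun := mk K A
  map_add' _ _ := rfl
  map_smul' _ _ := rfl
  map_lie' := rfl

lemma mkHom_eq_zero {x : FreeLieAlgebra K (CartanMatrix.Generators ι)}
    (hx : x ∈ CartanMatrix.Relations.toSet K A) : mkHom K A x = 0 :=
  LieSubmodule.Quotient.mk_eq_zero'.mpr (LieSubmodule.subset_lieSpan hx)

lemma chevalleyRelations : ChevalleyRelations A (h K A) (e K A) (f K A) where
  lie_h_h i j := mkHom_eq_zero K A (.inl (.inl (.inl (.inl (.inl ⟨(i, j), rfl⟩)))))
  lie_e_f i j := by
    have := mkHom_eq_zero K A (.inl (.inl (.inl (.inl (.inr ⟨(i, j), rfl⟩)))))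
    simp only [CartanMatrix.Relations.EF, Function.uncurry, Function.comp_apply] at this
    split_ifs at this ⊢ with hij
    · subst hij
      rw [map_sub, LieHom.map_lie, sub_eq_zero] at this
      exact this
    · rw [LieHom.map_lie] at this
      exact this
  lie_h_e i j := by
    have := mkHom_eq_zero K A (.inl (.inl (.inl (.inr ⟨(i, j), rfl⟩))))
    simp only [CartanMatrix.Relations.HE, Function.uncurry, Function.comp_apply] at this
    rw [map_sub, LieHom.map_lie, sub_eq_zero, map_zsmul] at this
    exact this
  lie_h_f i j := by
    have := mkHom_eq_zero K A (.inl (.inl (.inr ⟨(i, j), rfl⟩)))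
    simp only [CartanMatrix.Relations.HF, Function.uncurry, Function.comp_apply] at this
    rw [map_add, LieHom.map_lie, map_zsmul] at this
    exact eq_neg_of_add_eq_zero_left this

lemma mkHom_ad_pow (y x : FreeLieAlgebra K (CartanMatrix.Generators ι)) (n : ℕ) :
    mkHom K A ((LieAlgebra.ad K _ y ^ n) x) =
      (LieAlgebra.ad K _ (mkHom K A y) ^ n) (mkHom K A x) := by
  induction n with
  | zero => simp
  | succ n ih => simp [pow_succ', Module.End.mul_apply, ih]

lemma ad_e_pow_e (i j : ι) :
    (LieAlgebra.ad K _ (e K A i) ^ ((-A i j).toNat + 1)) (e K A j) = 0 := by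
  have := mkHom_eq_zero K A (.inl (.inr ⟨(i, j), rfl⟩))
  simp only [CartanMatrix.Relations.adE, Function.uncurry, Function.comp_apply] at this
  rw [mkHom_ad_pow, LieHom.map_lie] at this
  rw [pow_succ, Module.End.mul_apply, LieAlgebra.ad_apply]
  exact this

lemma ad_f_pow_f (i j : ι) :
    (LieAlgebra.ad K _ (f K A i) ^ ((-A i j).toNat + 1)) (f K A j) = 0 := by
  have := mkHom_eq_zero K A (.inr ⟨(i, j), rfl⟩)
  simp only [CartanMatrix.Relations.adF, Function.uncurry, Function.comp_apply] at this
  rw [mkHom_ad_pow, LieHom.map_lie] at this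
  rw [pow_succ, Module.End.mul_apply, LieAlgebra.ad_apply]
  exact this

lemma lieSpan_eq_top : LieSubalgebra.lieSpan K (Matrix.ToLieAlgebra K A)
    (Set.range (h K A) ∪ Set.range (e K A) ∪ Set.range (f K A)) = ⊤ := by
  rw [eq_top_iff]
  intro x _
  obtain ⟨y, rfl⟩ : ∃ y, mkHom K A y = x := Quot.exists_rep x
  have hy : mkHom K A y ∈ (⊤ : LieSubalgebra K _).map (mkHom K A) := ⟨y, trivial, rfl⟩
  rw [← lieSpan_range_freeLieAlgebra_of, LieSubalgebra.map_lieSpan] at hy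
  refine LieSubalgebra.lieSpan_mono ?_ hy
  rintro _ ⟨_, ⟨g, rfl⟩, rfl⟩
  rcases g with i | i | i
  · exact .inl (.inl ⟨i, rfl⟩)
  · exact .inl (.inr ⟨i, rfl⟩)
  · exact .inr ⟨i, rfl⟩

/-- The Chevalley generators `e_i` and `f_i` generate the Kac-Moody algebra. -/
lemma lieSubalgebra_eq_top (S : LieSubalgebra K (Matrix.ToLieAlgebra K A))
    (he : ∀ i, e K A i ∈ S) (hf : ∀ i, f K A i ∈ S) : S = ⊤ := by
  rw [eq_top_iff, ← lieSpan_eq_top, LieSubalgebra.lieSpan_le]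
  rintro y ((⟨i, rfl⟩ | ⟨i, rfl⟩) | ⟨i, rfl⟩)
  · have := (chevalleyRelations K A).lie_e_f i i
    rw [if_pos rfl] at this
    rw [← this]
    exact S.lie_mem (he i) (hf i)
  · exact he i
  · exact hf i

/-- The elements killed by some power of `ad e_i` form a subalgebra. It contains each `e_j` by the
Serre relations, and each `f_j` because `f_i ↦ h_i ↦ -2 e_i ↦ 0`. -/
lemma exists_ad_e_pow_eq_zero (i : ι) (x : Matrix.ToLieAlgebra K A) :
    ∃ n, (LieAlgebra.ad K _ (e K A i) ^ n) x = 0 := by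
  have : LieSubalgebra.engel K (e K A i) = ⊤ := by
    refine lieSubalgebra_eq_top K A _ (fun j => ?_) fun j => ?_ <;>
      rw [LieSubalgebra.mem_engel_iff]
    · exact ⟨_, ad_e_pow_e K A i j⟩
    · refine ⟨3, ?_⟩
      have H := chevalleyRelations K A
      simp only [pow_succ, pow_zero, one_mul, Module.End.mul_apply, LieAlgebra.ad_apply, H.lie_e_f]
      split_ifs
      · rw [← lie_skew _ (h K A i), H.lie_h_e]
        simp
      · simp
  rw [← LieSubalgebra.mem_engel_iff, this]
  exact LieSubalgebra.mem_top x

lemma exists_ad_f_pow_eq_zero (i : ι) (x : Matrix.ToLieAlgebra K A) :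
    ∃ n, (LieAlgebra.ad K _ (f K A i) ^ n) x = 0 := by
  have : LieSubalgebra.engel K (f K A i) = ⊤ := by
    refine lieSubalgebra_eq_top K A _ (fun j => ?_) fun j => ?_ <;>
      rw [LieSubalgebra.mem_engel_iff]
    · refine ⟨3, ?_⟩
      have H := (chevalleyRelations K A).symm
      simp only [pow_succ, pow_zero, one_mul, Module.End.mul_apply, LieAlgebra.ad_apply, H.lie_e_f]
      split_ifs
      · rw [← lie_skew _ ((-h K A) i), H.lie_h_e]
        simp
      · simp
    · exact ⟨_, ad_f_pow_f K A i j⟩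
  rw [← LieSubalgebra.mem_engel_iff, this]
  exact LieSubalgebra.mem_top x

variable {K A}

lemma e_ne_zero (hA : IsGCM A) (i : ι) : e K A i ≠ 0 := fun h0 => by
  have := (chevalleyRelations K A).lie_e_f i i
  rw [h0, zero_lie, if_pos rfl] at this
  exact h_ne_zero hA i this.symm

lemma f_ne_zero (hA : IsGCM A) (i : ι) : f K A i ≠ 0 := fun h0 => by
  have := (chevalleyRelations K A).lie_e_f i i
  rw [h0, lie_zero, if_pos rfl] at this
  exact h_ne_zero hA i this.symm

end Algebra

/-! ### Root spaces and their behaviour under simple reflections -/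

section RootSpaces

variable {K : Type*} [Field K] {ι : Type*} [Fintype ι] [DecidableEq ι] {A : Matrix ι ι ℤ}

lemma mem_rootSpace {k : ι → ℤ} {x : Matrix.ToLieAlgebra K A} :
    x ∈ rootSpace K A k ↔ ∀ i, ⁅h K A i, x⁆ = ((∑ j, A i j * k j : ℤ) : K) • x := Iff.rfl

lemma lie_mem_rootSpace {k l : ι → ℤ} {x y : Matrix.ToLieAlgebra K A}
    (hx : x ∈ rootSpace K A k) (hy : y ∈ rootSpace K A l) : ⁅x, y⁆ ∈ rootSpace K A (k + l) := by
  intro i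
  rw [leibniz_lie, hx i, hy i, lie_smul, smul_lie, ← add_smul, ← Int.cast_add,
    ← Finset.sum_add_distrib]
  simp only [Pi.add_apply, mul_add]

lemma e_mem_rootSpace (i : ι) : e K A i ∈ rootSpace K A (Pi.single i 1) := by
  intro j
  rw [(chevalleyRelations K A).lie_h_e, Int.cast_smul_eq_zsmul]
  simp [Pi.single_apply]

lemma f_mem_rootSpace (i : ι) : f K A i ∈ rootSpace K A (-Pi.single i 1) := by
  intro j
  rw [(chevalleyRelations K A).lie_h_f, Int.cast_smul_eq_zsmul]
  simp [Pi.single_apply]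

lemma RootWord.mem_rootSpace_e {x : Matrix.ToLieAlgebra K A} {k : ι → ℤ}
    (hx : RootWord (e K A) x k) : x ∈ rootSpace K A k := fun i => by
  rw [Int.cast_smul_eq_zsmul, hx.lie_h (chevalleyRelations K A)]

lemma RootWord.mem_rootSpace_f {x : Matrix.ToLieAlgebra K A} {k : ι → ℤ}
    (hx : RootWord (f K A) x k) : x ∈ rootSpace K A (-k) := fun i => by
  have := hx.lie_h (chevalleyRelations K A).symm i
  rw [Pi.neg_apply, neg_lie, neg_eq_iff_eq_neg] at this
  rw [Int.cast_smul_eq_zsmul, this]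
  simp

lemma ad_pow_mem_rootSpace {k l : ι → ℤ} {x y : Matrix.ToLieAlgebra K A}
    (hy : y ∈ rootSpace K A l) (hx : x ∈ rootSpace K A k) (n : ℕ) :
    (LieAlgebra.ad K _ y ^ n) x ∈ rootSpace K A (k + n • l) := fun i => by
  rw [lie_ad_pow_of_weight (hy i) (hx i)]
  congr 1
  simp only [Pi.add_apply, nsmul_eq_mul, mul_add, Finset.sum_add_distrib,
    Int.cast_add]
  congr 1
  rw [← Int.cast_natCast, ← Int.cast_mul, Finset.mul_sum]
  congr 1
  exact Finset.sum_congr rfl fun j _ => by simp; ring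

section CharZero

variable [CharZero K]

/-- Root spaces lie in simultaneous generalized eigenspaces of the commuting `ad h_i`. Injectivity
of `A` and characteristic zero make different `k` give different systems of eigenvalues. -/
lemma iSupIndep_rootSpace (hA : Function.Injective A.mulVec) : iSupIndep (rootSpace K A) := by
  have hcomm : ∀ i j, Commute (LieAlgebra.ad K (Matrix.ToLieAlgebra K A) (h K A i))
      (LieAlgebra.ad K (Matrix.ToLieAlgebra K A) (h K A j)) := fun i j => by
    refine LinearMap.ext fun x => ?_
    simp only [Module.End.mul_apply, LieAlgebra.ad_apply]
    rw [leibniz_lie, (chevalleyRelations K A).lie_h_h, zero_lie, zero_add]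
  have := Module.End.independent_iInf_maxGenEigenspace_of_forall_mapsTo
    (fun i => LieAlgebra.ad K (Matrix.ToLieAlgebra K A) (h K A i))
    (fun i j φ => Module.End.mapsTo_maxGenEigenspace_of_comm (hcomm j i) φ)
  have hinj : Function.Injective fun (k : ι → ℤ) i => ((∑ j, A i j * k j : ℤ) : K) :=
    fun k l hkl => hA (funext fun i => Int.cast_injective (congrFun hkl i))
  refine (this.comp hinj).mono fun k x hx => ?_
  simp only [Function.comp_apply, Submodule.mem_iInf]
  exact fun i => Module.End.mem_maxGenEigenspace _ _ _ |>.mpr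
    ⟨1, by simp [mem_rootSpace.mp hx i]⟩

/-- A spanning set of the root space of `k`. -/
def rootSet (K : Type*) [Field K] (A : Matrix ι ι ℤ) (k : ι → ℤ) :
    Set (Matrix.ToLieAlgebra K A) :=
  {x | RootWord (e K A) x k ∨ RootWord (f K A) x (-k) ∨ k = 0 ∧ x ∈ Set.range (h K A)}

/-- The spans on the right lie in the independent root spaces and already sum to the whole algebra,
so none can be smaller than its root space. -/
lemma rootSpace_eq_span (hA : Function.Injective A.mulVec) (k : ι → ℤ) :
    rootSpace K A k = Submodule.span K (rootSet K A k) := by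
  have hle : (fun k => Submodule.span K (rootSet K A k)) ≤ rootSpace K A := by
    refine fun k => Submodule.span_le.mpr ?_
    rintro x (hx | hx | ⟨rfl, i, rfl⟩)
    · exact hx.mem_rootSpace_e
    · exact neg_neg k ▸ hx.mem_rootSpace_f
    · intro j
      simp [(chevalleyRelations K A).lie_h_h]
  have htop : ⨆ k, Submodule.span K (rootSet K A k) = ⊤ := by
    rw [eq_top_iff, ← (chevalleyRelations K A).sup_eq_top (lieSpan_eq_top K A)]
    refine sup_le (sup_le ?_ ?_) ?_ <;> refine Submodule.span_le.mpr ?_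
    · exact fun x hx => Submodule.mem_iSup_of_mem 0 (Submodule.subset_span (.inr (.inr ⟨rfl, hx⟩)))
    · exact fun x ⟨k, hx⟩ => Submodule.mem_iSup_of_mem k (Submodule.subset_span (.inl hx))
    · refine fun x ⟨k, hx⟩ => Submodule.mem_iSup_of_mem (-k) (Submodule.subset_span (.inr (.inl ?_)))
      rwa [neg_neg]
  exact (congrFun (((iSupIndep_rootSpace hA).le_iff_eq_of_iSup_eq_top htop).mp hle) k).symm

lemma rootSpace_eq_bot_of_mixed (hA : Function.Injective A.mulVec) {k : ι → ℤ} {i j : ι}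
    (hi : 0 < k i) (hj : k j < 0) : rootSpace K A k = ⊥ := by
  rw [rootSpace_eq_span hA, Submodule.span_eq_bot]
  rintro x (hx | hx | ⟨rfl, -⟩)
  · exact absurd (hx.nonneg j) (not_le.mpr hj)
  · have := hx.nonneg i
    simp only [Pi.zero_apply, Pi.neg_apply] at this
    omega
  · simp at hi

lemma rootSpace_eq_bot_of_multiple (hA : Function.Injective A.mulVec) {k : ι → ℤ} {i : ι}
    (hi : 2 ≤ |k i|) (hk : ∀ j, j ≠ i → k j = 0) : rootSpace K A k = ⊥ := by
  rw [rootSpace_eq_span hA, Submodule.span_eq_bot]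
  rintro x (hx | hx | ⟨rfl, -⟩)
  · refine (hx.eq_zero_or_eq_simple i hk).resolve_right fun ⟨_, h1⟩ => ?_
    simp [h1] at hi
  · refine (hx.eq_zero_or_eq_simple i fun j hj => by simp [hk j hj]).resolve_right
      fun ⟨_, h1⟩ => ?_
    have := congrFun h1 i
    rw [← abs_neg, ← Pi.neg_apply, this] at hi
    simp at hi
  · simp at hi

/-- The root space of a simple root is spanned by the Chevalley generator. -/
lemma exists_eq_smul_e (hA : Function.Injective A.mulVec) {i : ι} {x : Matrix.ToLieAlgebra K A}
    (hx : x ∈ rootSpace K A (Pi.single i 1)) : ∃ c : K, x = c • e K A i := by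
  have hle : rootSpace K A (Pi.single i 1) ≤ Submodule.span K {e K A i} := by
    rw [rootSpace_eq_span hA, Submodule.span_le]
    rintro x (hx | hx | ⟨h0, -⟩)
    · rcases hx.eq_zero_or_eq_simple i fun j hj => Pi.single_eq_of_ne hj _ with rfl | ⟨rfl, -⟩
      · exact zero_mem _
      · exact Submodule.mem_span_singleton_self _
    · have := hx.nonneg i
      simp at this
    · simpa using congrFun h0 i
  obtain ⟨c, hc⟩ := Submodule.mem_span_singleton.mp (hle hx)
  exact ⟨c, hc.symm⟩

lemma eq_zero_of_ad_f_pow {k : ι → ℤ} {i : ι} (hd : A i i = 2) {n : ℕ}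
    (hn : ∑ j, A i j * k j = n) {x : Matrix.ToLieAlgebra K A} (hx : x ∈ rootSpace K A k)
    (h0 : (LieAlgebra.ad K _ (f K A i) ^ n) x = 0) : x = 0 := by
  have H := chevalleyRelations K A
  obtain ⟨N, hN⟩ := exists_ad_e_pow_eq_zero K A i x
  refine eq_zero_of_ad_pow_eq_zero (h := h K A i) (by rw [H.lie_e_f, if_pos rfl]) ?_ ?_ N n x ?_
    hN h0
  · rw [H.lie_h_e, hd, ← Int.cast_smul_eq_zsmul K]
    simp
  · rw [H.lie_h_f, hd, ← Int.cast_smul_eq_zsmul K]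
    simp
  · rw [hx i, hn, Int.cast_natCast]

lemma eq_zero_of_ad_e_pow {k : ι → ℤ} {i : ι} (hd : A i i = 2) {n : ℕ}
    (hn : ∑ j, A i j * k j = -n) {x : Matrix.ToLieAlgebra K A} (hx : x ∈ rootSpace K A k)
    (h0 : (LieAlgebra.ad K _ (e K A i) ^ n) x = 0) : x = 0 := by
  have H := (chevalleyRelations K A).symm
  obtain ⟨N, hN⟩ := exists_ad_f_pow_eq_zero K A i x
  refine eq_zero_of_ad_pow_eq_zero (h := (-h K A) i) (by rw [H.lie_e_f, if_pos rfl]) ?_ ?_ N n x ?_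
    hN h0
  · rw [H.lie_h_e, hd, ← Int.cast_smul_eq_zsmul K]
    simp
  · rw [H.lie_h_f, hd, ← Int.cast_smul_eq_zsmul K]
    simp
  · rw [Pi.neg_apply, neg_lie, hx i, hn]
    simp

/-- The action of the `i`-th simple reflection on the root lattice. -/
def reflect (A : Matrix ι ι ℤ) (i : ι) (k : ι → ℤ) : ι → ℤ :=
  k - Pi.single i (∑ j, A i j * k j)

/-- The support of the root space decomposition is stable under simple reflections. -/
lemma rootSpace_reflect_ne_bot {k : ι → ℤ} {i : ι} (hd : A i i = 2)
    (hk : rootSpace K A k ≠ ⊥) : rootSpace K A (reflect A i k) ≠ ⊥ := by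
  obtain ⟨x, hx, hx0⟩ := Submodule.exists_mem_ne_zero_of_ne_bot hk
  -- The reflected weight is reached by `ad(f_i)^n` or `ad(e_i)^n` according to the sign of the
  -- pairing, and this power is injective on the root space.
  obtain ⟨n, hn | hn⟩ := Int.eq_nat_or_neg (∑ j, A i j * k j)
  · refine Submodule.ne_bot_iff _ |>.mpr ⟨_, ?_, fun h0 => hx0 (eq_zero_of_ad_f_pow hd hn hx h0)⟩
    convert ad_pow_mem_rootSpace (f_mem_rootSpace i) hx n using 1
    rw [reflect, hn, sub_eq_add_neg, smul_neg, ← Pi.single_smul]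
    simp
  · refine Submodule.ne_bot_iff _ |>.mpr ⟨_, ?_, fun h0 => hx0 (eq_zero_of_ad_e_pow hd hn hx h0)⟩
    convert ad_pow_mem_rootSpace (e_mem_rootSpace i) hx n using 1
    rw [reflect, hn, sub_eq_add_neg, ← Pi.single_smul, ← Pi.single_neg]
    simp

end CharZero

end RootSpaces
end KacMoody

/-! ### Homomorphisms from quantum minimal surface algebras -/

namespace QMSA

variable {K : Type*} [Field K] {L : Type*} [LieRing L] [LieAlgebra K L]

/-- A family of elements satisfying the defining relations of a quantum minimal surface algebra
defines a homomorphism from that algebra. -/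
lemma exists_lieHom {n m : ℕ} {μ : Fin n → K} (v : Fin n → L)
    (hv : ∀ j, FreeLieAlgebra.lift K v (relator K n m μ j) = 0) :
    ∃ φ : QMSA K n m μ →ₗ⁅K⁆ L, ∀ i, φ (x K n m μ i) = v i := by
  have hle : QMSA.ideal K n m μ ≤ (FreeLieAlgebra.lift K v).ker := by
    refine LieSubmodule.lieSpan_le.mpr ?_
    rintro _ ⟨j, rfl⟩
    exact LieHom.mem_ker.mpr (hv j)
  let φ : QMSA K n m μ →ₗ[K] L := (QMSA.ideal K n m μ).toSubmodule.liftQ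
    (FreeLieAlgebra.lift K v : FreeLieAlgebra K (Fin n) →ₗ[K] L)
    fun y hy => LieHom.mem_ker.mp (hle hy)
  refine ⟨{ φ with map_lie' := fun {a b} => ?_ }, fun i => FreeLieAlgebra.lift_of_apply v i⟩
  obtain ⟨a, rfl⟩ := LieSubmodule.Quotient.surjective_mk' _ a
  obtain ⟨b, rfl⟩ := LieSubmodule.Quotient.surjective_mk' _ b
  exact LieHom.map_lie (FreeLieAlgebra.lift K v) a b

/-- Elements with `[v_i, [v_i, v_j]] = 0` for all `i`, `j` satisfy the relations with zero
spectrum. -/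
lemma lift_relator_eq_zero {n : ℕ} (m : ℕ) {v : Fin n → L} (hv : ∀ i j, ⁅v i, ⁅v i, v j⁆⁆ = 0)
    (j : Fin n) : FreeLieAlgebra.lift K v (relator K n m (fun _ => 0) j) = 0 := by
  rw [relator, zero_smul, sub_zero, map_sum]
  simp only [map_smul, LieHom.map_lie, FreeLieAlgebra.lift_of_apply, hv, smul_zero,
    Finset.sum_const_zero]

end QMSA

/-! ### The computation in type `E₁₀` -/

namespace E10

open KacMoody

lemma isGCM_cartan : IsGCM cartan where
  diag := by decide
  nonpos i j hij :=
    (by decide : ∀ i j : Fin 10, Matrix.of.symm cartan i j ≤ 0 ∨ i = j) i j |>.resolve_right hij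
  zero_symm i j h := ((by decide : cartan.IsSymm).apply i j).trans h

/-- The inverse of the Cartan matrix of type `E₁₀`, which is unimodular. -/
def cartanInv : Matrix (Fin 10) (Fin 10) ℤ :=
  !![ 0,  -1,  -2,  -3,  -4,  -5,  -6,  -4,  -2,  -3;
     -1,  -2,  -4,  -6,  -8, -10, -12,  -8,  -4,  -6;
     -2,  -4,  -6,  -9, -12, -15, -18, -12,  -6,  -9;
     -3,  -6,  -9, -12, -16, -20, -24, -16,  -8, -12;
     -4,  -8, -12, -16, -20, -25, -30, -20, -10, -15;
     -5, -10, -15, -20, -25, -30, -36, -24, -12, -18;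
     -6, -12, -18, -24, -30, -36, -42, -28, -14, -21;
     -4,  -8, -12, -16, -20, -24, -28, -18,  -9, -14;
     -2,  -4,  -6,  -8, -10, -12, -14,  -9,  -4,  -7;
     -3,  -6,  -9, -12, -15, -18, -21, -14,  -7, -10]

lemma cartanInv_mul_cartan : cartanInv * cartan = 1 := by
  decide +kernel

lemma mulVec_cartan_injective : Function.Injective cartan.mulVec := by
  intro k l hkl
  have := congrArg cartanInv.mulVec hkl
  rwa [Matrix.mulVec_mulVec, Matrix.mulVec_mulVec, cartanInv_mul_cartan, Matrix.one_mulVec,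
    Matrix.one_mulVec] at this

/-- `k` has coefficients of both signs, or is a proper multiple of a simple root. -/
def isMixedOrMultiple (k : Fin 10 → ℤ) : Bool :=
  ((List.finRange 10).any fun i => 0 < k i) && ((List.finRange 10).any fun i => k i < 0) ||
    (List.finRange 10).any fun i => 2 ≤ |k i| && (List.finRange 10).all fun j => j = i || k j = 0

/-- A sufficient criterion for the vanishing of the root space of `k`: at most `n` simple
reflections lead to a vector with coefficients of both signs, or to a proper multiple of a simple
root. -/
def vanishes : ℕ → (Fin 10 → ℤ) → Bool
  | 0, k => isMixedOrMultiple k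
  | n + 1, k => isMixedOrMultiple k || (List.finRange 10).any fun i =>
      -- This only prunes the search to reflections that move the height towards, or past, zero;
      -- soundness does not depend on it. The list tabulates the reflected vector, and its default
      -- value is never reached.
      0 < (∑ j, cartan i j * k j) * (∑ j, k j) &&
        vanishes n fun j => (List.ofFn (reflect cartan i k)).getD j 0

lemma rootSpace_eq_bot_of_isMixedOrMultiple (K : Type*) [Field K] [CharZero K] {k : Fin 10 → ℤ}
    (h : isMixedOrMultiple k = true) : rootSpace K cartan k = ⊥ := by
  simp only [isMixedOrMultiple, Bool.or_eq_true, Bool.and_eq_true, List.any_eq_true,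
    List.all_eq_true, decide_eq_true_eq, List.mem_finRange, true_and, forall_const] at h
  rcases h with ⟨⟨i, hi⟩, j, hj⟩ | ⟨i, hi, hk⟩
  · exact rootSpace_eq_bot_of_mixed mulVec_cartan_injective hi hj
  · exact rootSpace_eq_bot_of_multiple mulVec_cartan_injective hi
      fun j hj => (hk j).resolve_left hj

lemma rootSpace_eq_bot_of_vanishes (K : Type*) [Field K] [CharZero K] {n : ℕ} {k : Fin 10 → ℤ}
    (h : vanishes n k = true) : rootSpace K cartan k = ⊥ := by
  induction n generalizing k with
  | zero => exact rootSpace_eq_bot_of_isMixedOrMultiple K h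
  | succ n ih =>
    rw [vanishes, Bool.or_eq_true, List.any_eq_true] at h
    rcases h with h | ⟨i, -, h⟩
    · exact rootSpace_eq_bot_of_isMixedOrMultiple K h
    · rw [Bool.and_eq_true] at h
      by_contra hne
      refine rootSpace_reflect_ne_bot (isGCM_cartan.diag i) hne ?_
      rw [← ih h.2]
      congr 1
      funext j
      rw [List.getD_eq_getElem _ _ (by simp), List.getElem_ofFn]

/-- The weights of the 26 elements. -/
def weight : Fin 26 → Fin 10 → ℤ :=
  (Fin.append (fun i => -Pi.single i 1) roots : Fin (10 + 16) → Fin 10 → ℤ)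

lemma weight_injective : Function.Injective weight := by
  decide +kernel

/-- Any two of the weights have inner product at least `-1`, so `2γ + δ` has square length at least
`8 + 2 - 4 = 6`, too long for a root. The reflections certify this without the invariant form; depth
7 suffices for all pairs. -/
lemma vanishes_two_smul_weight_add_weight (i j : Fin 26) :
    vanishes 7 (weight i + (weight i + weight j)) = true := by
  revert i j
  decide +kernel

/-- Two reflections produce height 3; for height 2 one of them can be taken to act trivially. -/
lemma exists_roots_eq_reflect (k : Fin 16) : ∃ i j l : Fin 10,
    roots k = reflect cartan l (reflect cartan j (Pi.single i 1)) := by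
  revert k
  decide +kernel

/-- Pairing `1` with `α_j` makes `ad f_j` injective on the root space, so it sends the chosen root
vector to a non-zero multiple of `e_i`. -/
lemma exists_roots_eq_add (i : Fin 10) : ∃ k : Fin 16, ∃ j : Fin 10,
    roots k + 1 • -Pi.single j 1 = Pi.single i 1 ∧ ∑ l, cartan j l * roots k l = (1 : ℕ) := by
  revert i
  decide +kernel

variable {K : Type*} [Field K]

variable {e : Fin 16 → E10.LieAlg K}

lemma chi_mem_rootSpace (he : ∀ k, e k ∈ rootSpace K cartan (roots k) ∧ e k ≠ 0) (i : Fin 26) :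
    chi K e i ∈ rootSpace K cartan (weight i) ∧ chi K e i ≠ 0 := by
  refine Fin.addCases (m := 10) (n := 16) (motive := fun i =>
    chi K e i ∈ rootSpace K cartan (weight i) ∧ chi K e i ≠ 0) (fun i => ?_) (fun i => ?_) i
  · rw [chi, weight, Fin.append_left, Fin.append_left]
    exact ⟨f_mem_rootSpace i, f_ne_zero isGCM_cartan i⟩
  · rw [chi, weight, Fin.append_right, Fin.append_right]
    exact he i

variable [CharZero K]

lemma isRoot_roots (k : Fin 16) : IsRoot K cartan (roots k) := by
  constructor
  · revert k
    decide +kernel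
  · obtain ⟨i, j, l, h⟩ := exists_roots_eq_reflect k
    rw [h]
    refine rootSpace_reflect_ne_bot (isGCM_cartan.diag l)
      (rootSpace_reflect_ne_bot (isGCM_cartan.diag j) ?_)
    exact Submodule.ne_bot_iff _ |>.mpr
      ⟨_, e_mem_rootSpace i, KacMoody.e_ne_zero isGCM_cartan i⟩

lemma lieSpan_chi (he : ∀ k, e k ∈ rootSpace K cartan (roots k) ∧ e k ≠ 0) :
    LieSubalgebra.lieSpan K (E10.LieAlg K) (Set.range (chi K e)) = ⊤ := by
  have hf : ∀ i, f K cartan i ∈ LieSubalgebra.lieSpan K _ (Set.range (chi K e)) := fun i =>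
    LieSubalgebra.subset_lieSpan ⟨Fin.castAdd 16 i, Fin.append_left _ _ i⟩
  refine lieSubalgebra_eq_top K cartan _ (fun i => ?_) hf
  obtain ⟨k, j, hk, hn⟩ := exists_roots_eq_add i
  have hx := ad_pow_mem_rootSpace (f_mem_rootSpace j) (he k).1 1
  rw [hk, pow_one, LieAlgebra.ad_apply] at hx
  obtain ⟨c, hc⟩ := exists_eq_smul_e mulVec_cartan_injective hx
  have hc0 : c ≠ 0 := by
    rintro rfl
    refine (he k).2 (eq_zero_of_ad_f_pow (isGCM_cartan.diag j) hn (he k).1 ?_)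
    rw [pow_one, LieAlgebra.ad_apply, hc, zero_smul]
  rw [← inv_smul_smul₀ hc0 (KacMoody.e K cartan i), ← hc]
  exact LieSubalgebra.smul_mem _ _ (LieSubalgebra.lie_mem _ (hf j)
    (LieSubalgebra.subset_lieSpan ⟨Fin.natAdd 10 k, Fin.append_right _ _ k⟩))

lemma lie_chi_lie_chi (he : ∀ k, e k ∈ rootSpace K cartan (roots k) ∧ e k ≠ 0) (i j : Fin 26) :
    ⁅chi K e i, ⁅chi K e i, chi K e j⁆⁆ = 0 := by
  have hi := (chi_mem_rootSpace he i).1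
  have := lie_mem_rootSpace hi (lie_mem_rootSpace hi (chi_mem_rootSpace he j).1)
  rwa [rootSpace_eq_bot_of_vanishes K (vanishes_two_smul_weight_add_weight i j),
    Submodule.mem_bot] at this

lemma linearIndependent_chi (he : ∀ k, e k ∈ rootSpace K cartan (roots k) ∧ e k ≠ 0) :
    LinearIndependent K (chi K e) :=
  ((iSupIndep_rootSpace mulVec_cartan_injective).comp weight_injective).linearIndependent _
    (fun i => (chi_mem_rootSpace he i).1) fun i => (chi_mem_rootSpace he i).2

end E10

theorem mainTheorem6 (K : Type*) [RCLike K] :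
    (∀ k : Fin 16, KacMoody.IsRoot K E10.cartan (E10.roots k)) ∧
    ∀ e : Fin 16 → E10.LieAlg K,
      (∀ k, e k ∈ KacMoody.rootSpace K E10.cartan (E10.roots k) ∧ e k ≠ 0) →
      LieSubalgebra.lieSpan K (E10.LieAlg K) (Set.range (E10.chi K e)) = ⊤ ∧
      (∀ i j : Fin 26, ⁅E10.chi K e i, ⁅E10.chi K e i, E10.chi K e j⁆⁆ = 0) ∧
      LinearIndependent K (E10.chi K e) ∧
      ∀ m : ℕ, m ≤ 26 →
        ∃ φ : QMSA K 26 m (fun _ => 0) →ₗ⁅K⁆ E10.LieAlg K,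
          (∀ i, φ (QMSA.x K 26 m (fun _ => 0) i) = E10.chi K e i) ∧
          Function.Surjective φ := by
  refine ⟨E10.isRoot_roots, fun e he => ⟨E10.lieSpan_chi he, E10.lie_chi_lie_chi he,
    E10.linearIndependent_chi he, fun m _ => ?_⟩⟩
  obtain ⟨φ, hφ⟩ := QMSA.exists_lieHom (K := K) (E10.chi K e)
    (QMSA.lift_relator_eq_zero m (E10.lie_chi_lie_chi he))
  refine ⟨φ, hφ, ?_⟩
  rw [← LieHom.range_eq_top, eq_top_iff, ← E10.lieSpan_chi he, LieSubalgebra.lieSpan_le]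
  rintro _ ⟨i, rfl⟩
  exact ⟨_, hφ i⟩
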